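/- **Setting.** A hedonic market consists of: a compact set $Z\subset\mathbb R^{d_z}$ of feasible qualities; consumer types $\tilde x=(x,\varepsilon)\in\tilde X\subset\mathbb R^{d_x}\times\mathbb R^{d_z}$ and producer types $\tilde y\in\tilde Y\subset\mathbb R^{d_{\tilde y}}$ with distributions $P_{\tilde x}$, $P_{\tilde y}$; a utility $U(\tilde x,z)$, a cost $C(\tilde y,z)$, a price schedule $p:Z\to\mathbb R$; and a joint probability distribution $\gamma$ of $(\tilde x,z,\tilde y)$. Let $X$ be the projection of $\tilde X$ on the $x$-coordinate. Assume: * (Equilibrium) $\gamma$ has marginals $P_{\tilde x}$ and $P_{\tilde y}$, and for $\gamma$-almost all $(\tilde x,z,\tilde y)$: $z$ lies in the interior of $Z$, $U(\tilde x,z)-p(z)=\max_{z'\in Z}(U(\tilde x,z')-p(z'))$ and $p(z)-C(\tilde y,z)=\max_{z'\in Z}(p(z')-C(\tilde y,z'))$. * (Heterogeneity) $x\sim P_x$, the conditional distribution of $\varepsilon$ given $x$ is an a priori specified kernel $P_{\varepsilon|x}$ on $\mathbb R^{d_z}$, and $U(\tilde x,z)=\bar U(x,z)+\zeta(x,\varepsilon,z)$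 with $\zeta$ known and $\bar U$ unknown. * (Regularity) $U$, $C$ and $\zeta$ are twice continuously differentiable in all their arguments. * (Linearity in taste) $\zeta(x,\varepsilon,z)=z'\varepsilon$. * (Convexity) For every $x\in X$ the potential $V(x,z):=p(z)-\bar U(x,z)$ is convex in $z$, that is, $V(x,\cdot)$ is the restriction to $Z$ of a real-valued convex function on the convex hull of $Z$. Let $P_{xz}$ be the law of $(x,z)$ under $\gamma$ and $P_{z|x}$ a regular conditional distribution of $z$ given $x$. For $W:Z\to\mathbb R$ let $W^*(\varepsilon)=\sup_{z\in Z}(z'\varepsilon-W(z))$. **Theorem.** 1. $\nabla_z\bar U$ is the only marginal utility function compatible with $(P_{xz},p)$: if another market, with the same $Z$ and the same $P_{\varepsilon|x}$ but possibly different types of producers, cost, joint distribution and function $\bar U_1$, satisfies all the assumptions above and generates the same law $P_{xz}$ and the same price $p$ on $Z$, then for $P_x$-almost every $x$ and $P_{z|x}$-almost every $z$, $\bar U(x,\cdot)$ and $\bar U_1(x,\cdot)$ are differentiable at $z$ and $\nabla_z\bar U_1(x,z)=\nabla_z\bar U(x,z)$. 2. $\bar U(x,z)=p(z)-V(x,z)$,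 and for $P_x$-almost every $x$ such that $P_{\varepsilon|x}$ has a finite first moment, $V(x,\cdot)$ is convex and solves $$\min_W\Big(\int W\,dP_{z|x}+\int W^*\,dP_{\varepsilon|x}\Big),$$ the minimum being over all $W:Z\to\mathbb R$ with $W\in L^1(P_{z|x})$ and $W^*\in L^1(P_{\varepsilon|x})$. It is the convex solution in the following sense: for every convex solution $W$, * for $P_{z|x}$-almost every $z$, $V(x,\cdot)$ is differentiable at $z$ and $\nabla_zV(x,z)$ is a subgradient of $W$ at $z$, i.e. $W(z')\ge W(z)+\nabla_zV(x,z)'(z'-z)$ for all $z'\in Z$ (so that $\nabla W(z)=\nabla_zV(x,z)$ wherever $W$ is differentiable); * on every connected open subset of the support of $P_{z|x}$, $W$ and $V(x,\cdot)$ differ by a constant. -/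

import Mathlib

open MeasureTheory ProbabilityTheory

/-- Euclidean space of dimension `d`. -/
abbrev Vec (d : ℕ) : Type := EuclideanSpace ℝ (Fin d)

/-- The data of a hedonic market: type spaces and type distributions, the compact set of feasible
qualities, utility, cost, the price schedule, and the joint law of
(consumer type, traded quality, producer type). A consumer type is a pair `(x, ε)` of an observable
and an unobservable part; `ε` has the dimension of a quality. -/
structure HedonicMarket (dx dz dy : ℕ) where
  /-- consumer types `(x, ε)` -/
  consumers : Set (Vec dx × Vec dz)
  /-- producer types -/
  producers : Set (Vec dy)
  /-- feasible qualities -/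
  Z : Set (Vec dz)
  /-- distribution of consumer types -/
  Pcons : Measure (Vec dx × Vec dz)
  /-- distribution of producer types -/
  Pprod : Measure (Vec dy)
  /-- distribution of the observable part of the consumer type -/
  Px : Measure (Vec dx)
  /-- a priori specified conditional distribution of the unobservable part -/
  Peps : Kernel (Vec dx) (Vec dz)
  /-- utility of consumer `(x, ε)` from quality `z` -/
  U : Vec dx × Vec dz → Vec dz → ℝ
  /-- the unknown part of utility, a function of `x` and `z` -/
  Ubar : Vec dx → Vec dz → ℝ
  /-- the known part of utility, a function of `x`, `ε` and `z` -/
  zeta : Vec dx → Vec dz → Vec dz → ℝ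
  /-- cost of quality `z` for a producer -/
  cost : Vec dy → Vec dz → ℝ
  /-- price schedule -/
  price : Vec dz → ℝ
  /-- joint distribution of (consumer type, traded quality, producer type) -/
  joint : Measure ((Vec dx × Vec dz) × Vec dz × Vec dy)
  isCompact_Z : IsCompact Z
  isProbabilityMeasure_Px : IsProbabilityMeasure Px
  isMarkovKernel_Peps : IsMarkovKernel Peps
  isProbabilityMeasure_joint : IsProbabilityMeasure joint
  ae_mem_consumers : ∀ᵐ t ∂Pcons, t ∈ consumers
  ae_mem_producers : ∀ᵐ y ∂Pprod, y ∈ producers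

namespace HedonicMarket

variable {dx dz dy : ℕ} (M : HedonicMarket dx dz dy)

instance : IsProbabilityMeasure M.joint := M.isProbabilityMeasure_joint

/-- The set `X` of observable types. -/
def observables : Set (Vec dx) := Prod.fst '' M.consumers

/-- The joint distribution `P_{xz}` of observable types and traded qualities. -/
noncomputable def Pxz : Measure (Vec dx × Vec dz) :=
  M.joint.map (fun w => (w.1.1, w.2.1))

instance : IsFiniteMeasure M.Pxz := by unfold Pxz; infer_instance

/-- The conditional distribution `P_{z|x}` of traded qualities given the observable type
(a regular conditional distribution, unique up to `P_x`-null sets of `x`). -/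
noncomputable def PzGiven : Kernel (Vec dx) (Vec dz) := M.Pxz.condKernel

/-- The consumer's potential `V(x, z) = p(z) - Ubar(x, z)`. -/
def potential (x : Vec dx) (z : Vec dz) : ℝ := M.price z - M.Ubar x z

/-- Equilibrium concept: the joint law has the given marginals, almost every consumer and producer
is matched with a feasible quality that is optimal given prices, and observed qualities lie in the
interior of the set of feasible qualities. (The joint surplus is finite because `U` and the cost are
real valued.) -/
structure IsEquilibrium : Prop where
  map_consumer : M.joint.map (fun w => w.1) = M.Pcons
  map_producer : M.joint.map (fun w => w.2.2) = M.Pprod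
  feasible : ∀ᵐ w ∂M.joint, w.2.1 ∈ M.Z
  consumer_optimal : ∀ᵐ w ∂M.joint, IsMaxOn (fun z => M.U w.1 z - M.price z) M.Z w.2.1
  producer_optimal : ∀ᵐ w ∂M.joint, IsMaxOn (fun z => M.price z - M.cost w.2.2 z) M.Z w.2.1
  interior : ∀ᵐ w ∂M.joint, w.2.1 ∈ interior M.Z

/-- Unobserved heterogeneity: `x` has law `P_x`, `ε` has the specified conditional law given `x`,
and `U((x, ε), z) = Ubar(x, z) + ζ(x, ε, z)`. -/
structure HasUnobservedHeterogeneity : Prop where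
  disintegration : M.Pcons = M.Px ⊗ₘ M.Peps
  decomposition : ∀ t ∈ M.consumers, ∀ z ∈ M.Z, M.U t z = M.Ubar t.1 z + M.zeta t.1 t.2 z

/-- Regularity: `U`, the cost and `ζ` are twice continuously differentiable in all arguments. -/
structure IsRegular : Prop where
  contDiffOn_U : ContDiffOn ℝ 2 (fun q : (Vec dx × Vec dz) × Vec dz => M.U q.1 q.2)
    (M.consumers ×ˢ M.Z)
  contDiffOn_cost : ContDiffOn ℝ 2 (fun q : Vec dy × Vec dz => M.cost q.1 q.2)
    (M.producers ×ˢ M.Z)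
  contDiffOn_zeta : ContDiffOn ℝ 2
    (fun q : (Vec dx × Vec dz) × Vec dz => M.zeta q.1.1 q.1.2 q.2) (M.consumers ×ˢ M.Z)

/-- Marginal utility linear in taste: `ζ(x, ε, z) = z'ε`. -/
def IsLinearInTaste : Prop :=
  ∀ t ∈ M.consumers, ∀ z ∈ M.Z, M.zeta t.1 t.2 z = inner ℝ z t.2

end HedonicMarket

/-- A real function on a set `Z`, not assumed convex, is convex if it is the restriction to `Z` of a
real-valued convex function on the convex hull of `Z`. For convex `Z` this is the usual notion. -/
def IsConvexFunOn {d : ℕ} (Z : Set (Vec d)) (f : Vec d → ℝ) : Prop :=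
  ∃ F : Vec d → ℝ, ConvexOn ℝ (convexHull ℝ Z) F ∧ Set.EqOn f F Z

/-- Convexity restriction: `z ↦ V(x, z)` is convex for every observable type `x`. -/
def HedonicMarket.HasConvexPotential {dx dz dy : ℕ} (M : HedonicMarket dx dz dy) : Prop :=
  ∀ x ∈ M.observables, IsConvexFunOn M.Z (M.potential x)

/-- The convex conjugate `W*(ε) = sup_{z ∈ Z} (z'ε - W(z))`, with values in the extended reals. -/
noncomputable def convexConjugate {d : ℕ} (Z : Set (Vec d)) (W : Vec d → ℝ) (e : Vec d) : EReal :=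
  ⨆ z ∈ Z, ((inner ℝ z e - W z : ℝ) : EReal)

/-- `W` and its convex conjugate are integrable; in particular the conjugate is almost everywhere
finite. (It is never `⊥` when `Z` is nonempty.) -/
structure DualAdmissible {d : ℕ} (Z : Set (Vec d)) (μ ν : Measure (Vec d)) (W : Vec d → ℝ) :
    Prop where
  integrable : Integrable W μ
  conjugate_lt_top : ∀ᵐ e ∂ν, convexConjugate Z W e < ⊤
  integrable_conjugate : Integrable (fun e => (convexConjugate Z W e).toReal) ν

/-- The objective `E_z[W(z)] + E_ε[W*(ε)]` with `z ∼ μ` and `ε ∼ ν`. -/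
noncomputable def dualObjective {d : ℕ} (Z : Set (Vec d)) (μ ν : Measure (Vec d))
    (W : Vec d → ℝ) : ℝ :=
  ∫ z, W z ∂μ + ∫ e, (convexConjugate Z W e).toReal ∂ν

/-- `W` attains the minimum of `E_z[W(z)] + E_ε[W*(ε)]`. -/
def IsDualMinimizer {d : ℕ} (Z : Set (Vec d)) (μ ν : Measure (Vec d)) (W : Vec d → ℝ) : Prop :=
  DualAdmissible Z μ ν W ∧
    ∀ W' : Vec d → ℝ, DualAdmissible Z μ ν W' →
      dualObjective Z μ ν W ≤ dualObjective Z μ ν W'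

/-!
Conditionally on the observable type `x`, the equilibrium is a coupling of the quality law `P_{z|x}`
and the taste law `P_{ε|x}` in which almost every quality `z` maximises `⟨·, ε⟩ - V(x, ·)` over `Z`
(`HedonicMarket.exists_conditional_coupling`). The price is differentiable at almost every traded
quality, since up to constants it is squeezed there between the utility of the consumer and the cost
of the producer, both differentiable. Hence so is `V(x, ·)`, and as traded qualities are interior,
the first-order condition reads `ε = ∇V(x, z)`.

Uniqueness of marginal utility. A second market gives another coupling with the same marginals, for
a potential `V₁`. Put `f = V - V₁` and `g = V₁* - V*`. By the Fenchel–Young inequality `f(z) ≤ g(ε)`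
almost surely in the first coupling and `g(ε) ≤ f(z)` in the second. Since the laws of `z` and `ε`
are common to both, the integrals of `arctan ∘ f` and `arctan ∘ g` agree, so the first inequality is
an equality: `z` is also optimal for `V₁` at taste `ε` (`isMaxOn_of_map_eq_map`). The first-order
conditions for `V` and `V₁` at the same `(z, ε)` then give `∇V = ∇V₁`. No moment condition on `ε` is
needed because `arctan` is bounded.

Dual problem. Fenchel–Young bounds the objective below by `∫ ⟨z, ε⟩`, with equality for `V`
(`isDualMinimizer_of_isMaxOn`). Every other solution `W` therefore satisfies Fenchel–Young with
equality, so `ε = ∇V(x, z)` is a subgradient of `W` at `z` (`IsDualMinimizer.ae_isMaxOn`). On an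
open subset of the support the two functions thus have common subgradients on a dense set, and by
local boundedness of subgradients at every point. Summing the subgradient inequalities along a
subdivided segment telescopes to an error of order `1 / n`, so that `W - V` is locally constant
(`exists_eq_add_const_of_common_subgradient`).
-/

/-! ### Differentiability at points of contact -/

/-- A function squeezed between two differentiable functions that touch at `x` is differentiable
at `x`. -/
theorem differentiableAt_of_le_of_le {E : Type*} [NormedAddCommGroup E] [NormedSpace ℝ E]
    {f g h : E → ℝ} {x : E} (hf : DifferentiableAt ℝ f x) (hh : DifferentiableAt ℝ h x)
    (hfg : ∀ᶠ y in nhds x, f y ≤ g y) (hgh : ∀ᶠ y in nhds x, g y ≤ h y)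
    (hfx : f x = g x) (hhx : g x = h x) : DifferentiableAt ℝ g x := by
  have hmin : IsLocalMin (fun y => h y - f y) x := by
    filter_upwards [hfg, hgh] with y h1 h2
    linarith
  have hd : fderiv ℝ f x = fderiv ℝ h x := by
    have := hmin.fderiv_eq_zero
    rw [fderiv_fun_sub hh hf] at this
    exact (sub_eq_zero.1 this).symm
  have hf' := hf.hasFDerivAt.isLittleO
  have hh' := hh.hasFDerivAt.isLittleO
  rw [← hd] at hh'
  refine HasFDerivAt.differentiableAt (f' := fderiv ℝ f x) (.of_isLittleO ?_)
  refine Asymptotics.IsBigO.trans_isLittleO (Asymptotics.IsBigO.of_bound 1 ?_)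
    (hf'.norm_left.add hh'.norm_left)
  filter_upwards [hfg, hgh] with y h1 h2
  rw [one_mul, Real.norm_eq_abs, Real.norm_eq_abs, Real.norm_eq_abs, Real.norm_eq_abs]
  refine le_trans ?_ (le_abs_self _)
  refine abs_le.2 ⟨?_, ?_⟩
  · have := neg_abs_le (f y - f x - (fderiv ℝ f x) (y - x))
    have := abs_nonneg (h y - h x - (fderiv ℝ f x) (y - x))
    linarith
  · have := le_abs_self (h y - h x - (fderiv ℝ f x) (y - x))
    have := abs_nonneg (f y - f x - (fderiv ℝ f x) (y - x))
    linarith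

/-- First-order condition: at an interior maximiser of `z ↦ ⟨z, e⟩ - V z` the gradient of `V`
is `e`. -/
theorem gradient_eq_of_isMaxOn_inner_sub {d : ℕ} {Z : Set (Vec d)} {V : Vec d → ℝ} {z e : Vec d}
    (hz : z ∈ interior Z) (hmax : IsMaxOn (fun z' => inner ℝ z' e - V z') Z z)
    (hV : DifferentiableAt ℝ V z) : gradient V z = e := by
  have hloc : IsLocalMax (fun z' => inner ℝ e z' - V z') z := by
    filter_upwards [mem_interior_iff_mem_nhds.1 hz] with y hy
    have := hmax hy
    simpa [real_inner_comm] using this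
  have h0 := hloc.fderiv_eq_zero
  have hL : HasFDerivAt (fun z' : Vec d => inner ℝ e z') (innerSL ℝ e) z :=
    (innerSL ℝ e).hasFDerivAt
  rw [(hL.fun_sub hV.hasFDerivAt).fderiv, sub_eq_zero] at h0
  rw [gradient, ← h0]
  exact (InnerProductSpace.toDual ℝ (Vec d)).symm_apply_apply e

/-! ### Functions with common subgradients -/

/-- Subgradients of a continuous function are locally bounded. -/
theorem norm_subgradient_le {d : ℕ} {O : Set (Vec d)} {V : Vec d → ℝ} {z w g : Vec d} {r C : ℝ}
    (hr : 0 < r) (hO : Metric.closedBall z (2 * r) ⊆ O)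
    (hC : ∀ y ∈ Metric.closedBall z (2 * r), ‖V y‖ ≤ C) (hw : w ∈ Metric.ball z r)
    (hg : ∀ y ∈ O, V w + inner ℝ g (y - w) ≤ V y) : ‖g‖ ≤ 2 * C / r := by
  rw [Metric.mem_ball, dist_eq_norm] at hw
  have hwC : w ∈ Metric.closedBall z (2 * r) := by
    rw [Metric.mem_closedBall, dist_eq_norm]; linarith
  have hC0 : 0 ≤ C := (norm_nonneg _).trans (hC w hwC)
  rcases eq_or_ne g 0 with rfl | hg0
  · rw [norm_zero]; positivity
  have hgn : 0 < ‖g‖ := norm_pos_iff.2 hg0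
  have hy : w + (r / ‖g‖) • g ∈ Metric.closedBall z (2 * r) := by
    rw [Metric.mem_closedBall, dist_eq_norm]
    have h1 : ‖(r / ‖g‖) • g‖ = r := by
      rw [norm_smul, Real.norm_eq_abs, abs_of_pos (by positivity)]
      field_simp
    calc ‖w + (r / ‖g‖) • g - z‖ = ‖(w - z) + (r / ‖g‖) • g‖ := by congr 1; abel
      _ ≤ ‖w - z‖ + ‖(r / ‖g‖) • g‖ := norm_add_le _ _
      _ ≤ 2 * r := by rw [h1]; linarith
  have h2 := hg _ (hO hy)
  have h3 : inner ℝ g (w + (r / ‖g‖) • g - w) = r * ‖g‖ := by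
    rw [add_sub_cancel_left, inner_smul_right, real_inner_self_eq_norm_sq]
    field_simp
  have h4 := abs_le.1 (hC _ hy)
  have h5 := abs_le.1 (hC _ hwC)
  rw [le_div_iff₀ hr]
  linarith [h4.2, h5.1, mul_comm r ‖g‖]

/-- Two continuous functions that have a common subgradient on a dense set of points have one
everywhere. -/
theorem exists_common_subgradient_of_mem_closure {d : ℕ} {O : Set (Vec d)} (hO : IsOpen O)
    {V W : Vec d → ℝ} (hV : ContinuousOn V O) (hW : ContinuousOn W O) {z : Vec d} (hz : z ∈ O)
    (hcl : z ∈ closure {w ∈ O | ∃ g : Vec d, ∀ y ∈ O,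
      V w + inner ℝ g (y - w) ≤ V y ∧ W w + inner ℝ g (y - w) ≤ W y}) :
    ∃ g : Vec d, ∀ y ∈ O,
      V z + inner ℝ g (y - z) ≤ V y ∧ W z + inner ℝ g (y - z) ≤ W y := by
  obtain ⟨s, hs, hsz⟩ := mem_closure_iff_seq_limit.1 hcl
  choose hsO g hg using hs
  obtain ⟨R, hR, hRO⟩ := Metric.nhds_basis_closedBall.mem_iff.1 (hO.mem_nhds hz)
  obtain ⟨r, hr, rfl⟩ : ∃ r, 0 < r ∧ 2 * r = R := ⟨R / 2, by positivity, by ring⟩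
  obtain ⟨C, hC⟩ := (isCompact_closedBall z (2 * r)).exists_bound_of_continuousOn (hV.mono hRO)
  have hbd : ∀ᶠ n in Filter.atTop, g n ∈ Metric.closedBall 0 (2 * C / r) := by
    filter_upwards [hsz.eventually (Metric.ball_mem_nhds z hr)] with n hn
    rw [mem_closedBall_zero_iff]
    exact norm_subgradient_le hr hRO hC hn fun y hy => (hg n y hy).1
  obtain ⟨g₀, -, φ, hφ, hφg⟩ :=
    tendsto_subseq_of_frequently_bounded Metric.isBounded_closedBall hbd.frequently
  have hsφ := hsz.comp hφ.tendsto_atTop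
  have key : ∀ F : Vec d → ℝ, ContinuousOn F O → ∀ y : Vec d,
      (∀ n, F (s n) + inner ℝ (g n) (y - s n) ≤ F y) → F z + inner ℝ g₀ (y - z) ≤ F y := by
    intro F hF y hy
    have hFz : Filter.Tendsto (fun n => F (s (φ n))) Filter.atTop (nhds (F z)) :=
      (hF.continuousAt (hO.mem_nhds hz)).tendsto.comp hsφ
    exact le_of_tendsto' (hFz.add (hφg.inner (tendsto_const_nhds.sub hsφ))) fun n => hy (φ n)
  exact ⟨g₀, fun y hy =>
    ⟨key V hV y fun n => (hg n y hy).1, key W hW y fun n => (hg n y hy).2⟩⟩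

/-- Subdividing the segment from `a` to `b` into `n` parts and adding up the subgradient
inequalities gives a telescoping sum of order `1 / n`. -/
theorem sub_le_sub_of_common_subgradient {d : ℕ} {S : Set (Vec d)} (hS : Convex ℝ S)
    {V W : Vec d → ℝ} (h : ∀ z ∈ S, ∃ g : Vec d, ∀ y ∈ S,
      V z + inner ℝ g (y - z) ≤ V y ∧ W z + inner ℝ g (y - z) ≤ W y)
    {a b : Vec d} (ha : a ∈ S) (hb : b ∈ S) : W a - V a ≤ W b - V b := by
  choose! g hg using h
  have key : ∀ n : ℕ, 0 < n →
      inner ℝ (g a) (b - a) - inner ℝ (g b) (b - a) ≤ n * ((W b - V b) - (W a - V a)) := by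
    intro n hn
    have hn' : (0 : ℝ) < n := Nat.cast_pos.2 hn
    let p : ℕ → Vec d := fun i => a + ((i : ℝ) / n) • (b - a)
    have hp : ∀ i ≤ n, p i ∈ S := fun i hi =>
      hS.add_smul_sub_mem ha hb ⟨by positivity, (div_le_one hn').2 (Nat.cast_le.2 hi)⟩
    have hstep : ∀ i, p (i + 1) - p i = (1 / (n : ℝ)) • (b - a) := by
      intro i
      simp only [p, add_sub_add_left_eq_sub, ← sub_smul]
      congr 1
      push_cast
      field_simp
      ring
    have h1 : ∀ i ∈ Finset.range n, inner ℝ (g (p i)) (b - a) - inner ℝ (g (p (i + 1))) (b - a) ≤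
        n * (W (p (i + 1)) - V (p (i + 1))) - n * (W (p i) - V (p i)) := by
      intro i hi
      have hi' := Finset.mem_range.1 hi
      have hW := (hg _ (hp i hi'.le) _ (hp (i + 1) hi')).2
      have hV := (hg _ (hp (i + 1) hi') _ (hp i hi'.le)).1
      rw [← neg_sub, inner_neg_right, hstep, inner_smul_right] at hV
      rw [hstep, inner_smul_right] at hW
      have e1 : ∀ t : ℝ, n * (1 / (n : ℝ) * t) = t := fun t => by field_simp
      have := mul_le_mul_of_nonneg_left (add_le_add hW hV) hn'.le
      have e2 := e1 (inner ℝ (g (p i)) (b - a))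
      have e3 := e1 (inner ℝ (g (p (i + 1))) (b - a))
      nlinarith
    have h2 := Finset.sum_le_sum h1
    rw [Finset.sum_range_sub', Finset.sum_range_sub (fun i => n * (W (p i) - V (p i)))] at h2
    have hp0 : p 0 = a := by simp [p]
    have hpn : p n = b := by simp [p, hn'.ne']
    rw [hp0, hpn, ← mul_sub] at h2
    exact h2
  by_contra! hlt
  obtain ⟨n, hn⟩ := exists_nat_gt
    ((inner ℝ (g b) (b - a) - inner ℝ (g a) (b - a)) / ((W a - V a) - (W b - V b)))
  have hpos : 0 < (W a - V a) - (W b - V b) := sub_pos.2 hlt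
  rw [div_lt_iff₀ hpos] at hn
  have h1 := key (n + 1) n.succ_pos
  push_cast at h1
  nlinarith

/-- Continuous functions with a common subgradient at densely many points of a connected open set
differ by a constant there. -/
theorem exists_eq_add_const_of_common_subgradient {d : ℕ} {O : Set (Vec d)} (hO : IsOpen O)
    (hOc : IsPreconnected O) {V W : Vec d → ℝ} (hV : ContinuousOn V O) (hW : ContinuousOn W O)
    (hd : O ⊆ closure {w ∈ O | ∃ g : Vec d, ∀ y ∈ O,
      V w + inner ℝ g (y - w) ≤ V y ∧ W w + inner ℝ g (y - w) ≤ W y}) :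
    ∃ c : ℝ, ∀ z ∈ O, W z = V z + c := by
  have hsub := fun (z : Vec d) (hz : z ∈ O) => exists_common_subgradient_of_mem_closure hO hV hW hz (hd hz)
  have hloc : ∀ z ∈ O, (fun y => W y - V y) =ᶠ[nhds z] fun _ => W z - V z := by
    intro z hz
    obtain ⟨r, hr, hrO⟩ := Metric.isOpen_iff.1 hO z hz
    have hball : ∀ w ∈ Metric.ball z r, ∃ g : Vec d, ∀ y ∈ Metric.ball z r,
        V w + inner ℝ g (y - w) ≤ V y ∧ W w + inner ℝ g (y - w) ≤ W y := fun w hw =>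
      let ⟨g, hg⟩ := hsub w (hrO hw)
      ⟨g, fun y hy => hg y (hrO hy)⟩
    filter_upwards [Metric.ball_mem_nhds z hr] with y hy
    have hzm := Metric.mem_ball_self hr (x := z)
    exact le_antisymm
      (sub_le_sub_of_common_subgradient (convex_ball z r) hball hy hzm)
      (sub_le_sub_of_common_subgradient (convex_ball z r) hball hzm hy)
  have hdiff : ∀ z ∈ O, HasFDerivAt (fun y => W y - V y) (0 : Vec d →L[ℝ] ℝ) z := fun z hz =>
    (hasFDerivAt_const (W z - V z) z).congr_of_eventuallyEq (hloc z hz)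
  obtain ⟨c, hc⟩ := hO.exists_is_const_of_fderiv_eq_zero hOc
    (fun z hz => (hdiff z hz).differentiableAt.differentiableWithinAt)
    (fun z hz => (hdiff z hz).fderiv)
  exact ⟨c, fun z hz => by have := hc z hz; linarith⟩

/-! ### Convex conjugates -/

theorem inner_sub_le_convexConjugate {d : ℕ} {Z : Set (Vec d)} (W : Vec d → ℝ) {z : Vec d}
    (hz : z ∈ Z) (e : Vec d) :
    ((inner ℝ z e - W z : ℝ) : EReal) ≤ convexConjugate Z W e :=
  le_iSup₂ (f := fun z (_ : z ∈ Z) => ((inner ℝ z e - W z : ℝ) : EReal)) z hz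

theorem convexConjugate_le_iff_isMaxOn {d : ℕ} {Z : Set (Vec d)} {W : Vec d → ℝ} {z e : Vec d} :
    convexConjugate Z W e ≤ ((inner ℝ z e - W z : ℝ) : EReal) ↔
      IsMaxOn (fun z' => inner ℝ z' e - W z') Z z := by
  simp only [convexConjugate, iSup_le_iff, EReal.coe_le_coe_iff]
  exact Iff.rfl

theorem convexConjugate_eq_of_isMaxOn {d : ℕ} {Z : Set (Vec d)} {W : Vec d → ℝ} {z e : Vec d}
    (hz : z ∈ Z) (h : IsMaxOn (fun z' => inner ℝ z' e - W z') Z z) :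
    convexConjugate Z W e = ((inner ℝ z e - W z : ℝ) : EReal) :=
  le_antisymm (convexConjugate_le_iff_isMaxOn.2 h) (inner_sub_le_convexConjugate W hz e)

/-- Conjugates are lower semicontinuous, whatever the function. -/
theorem measurable_convexConjugate {d : ℕ} (Z : Set (Vec d)) (W : Vec d → ℝ) :
    Measurable (convexConjugate Z W) := by
  refine LowerSemicontinuous.measurable ?_
  refine lowerSemicontinuous_biSup fun z _ => Continuous.lowerSemicontinuous ?_
  exact continuous_coe_real_ereal.comp (by fun_prop)

/-- The Fenchel–Young inequality. -/
theorem inner_le_add_toReal_convexConjugate {d : ℕ} {Z : Set (Vec d)} {W : Vec d → ℝ}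
    {z e : Vec d} (hz : z ∈ Z) (htop : convexConjugate Z W e < ⊤) :
    inner ℝ z e ≤ W z + (convexConjugate Z W e).toReal := by
  have h := EReal.toReal_le_toReal (inner_sub_le_convexConjugate W hz e)
    (EReal.coe_ne_bot _) htop.ne
  rw [EReal.toReal_coe] at h
  linarith

theorem isMaxOn_of_add_toReal_convexConjugate_le {d : ℕ} {Z : Set (Vec d)} {W : Vec d → ℝ}
    {z e : Vec d} (htop : convexConjugate Z W e < ⊤)
    (h : W z + (convexConjugate Z W e).toReal ≤ inner ℝ z e) :
    IsMaxOn (fun z' => inner ℝ z' e - W z') Z z := by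
  intro z' hz'
  have := inner_le_add_toReal_convexConjugate (W := W) hz' htop
  change inner ℝ z' e - W z' ≤ inner ℝ z e - W z
  linarith

/-! ### Couplings of qualities and tastes in which qualities are chosen optimally -/

theorem aemeasurable_of_continuousOn_interior {d : ℕ} {Z : Set (Vec d)} {V : Vec d → ℝ}
    {μ : Measure (Vec d)} (hV : ContinuousOn V (interior Z)) (hμ : ∀ᵐ z ∂μ, z ∈ interior Z) :
    AEMeasurable V μ := by
  have h := hV.aemeasurable (μ := μ) isOpen_interior.measurableSet
  rwa [Measure.restrict_eq_self_of_ae_mem hμ] at h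

theorem ae_map_mem_interior {d : ℕ} {Ω : Type*} [MeasurableSpace Ω] {π : Measure Ω}
    {Z : Set (Vec d)} {z : Ω → Vec d} (hz : Measurable z) (h : ∀ᵐ ω ∂π, z ω ∈ interior Z) :
    ∀ᵐ x ∂(π.map z), x ∈ interior Z :=
  (ae_map_iff (p := (· ∈ interior Z)) hz.aemeasurable isOpen_interior.measurableSet).2 h

/-- Two couplings with the same marginals, each supported by optimal choices for its own potential:
choices of the first coupling are optimal for the potential of the second as well. With
`f = V - V'` and `g = V'* - V*`, the inequality `f z ≤ g e` holds under the first coupling and the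
opposite one under the second. As the marginals agree, comparing the integrals of `arctan f`
and `arctan g` forces equality. No moments are needed because `arctan` is bounded. -/
theorem isMaxOn_of_map_eq_map {d : ℕ} {Ω Ω' : Type*} [MeasurableSpace Ω] [MeasurableSpace Ω']
    {π : Measure Ω} {π' : Measure Ω'} [IsProbabilityMeasure π] [IsProbabilityMeasure π']
    {Z : Set (Vec d)} {V V' : Vec d → ℝ} {z e : Ω → Vec d} {z' e' : Ω' → Vec d}
    (hz : Measurable z) (he : Measurable e) (hz' : Measurable z') (he' : Measurable e')
    (hzz : π.map z = π'.map z') (hee : π.map e = π'.map e')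
    (hf : AEMeasurable (fun x => V x - V' x) (π.map z))
    (hopt : ∀ᵐ ω ∂π, z ω ∈ Z ∧ IsMaxOn (fun x => inner ℝ x (e ω) - V x) Z (z ω))
    (hopt' : ∀ᵐ ω ∂π', z' ω ∈ Z ∧ IsMaxOn (fun x => inner ℝ x (e' ω) - V' x) Z (z' ω)) :
    ∀ᵐ ω ∂π, IsMaxOn (fun x => inner ℝ x (e ω) - V' x) Z (z ω) := by
  have hfin : ∀ᵐ ω ∂π, convexConjugate Z V' (e ω) < ⊤ := by
    refine ae_of_ae_map he.aemeasurable (p := fun x => convexConjugate Z V' x < ⊤) ?_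
    rw [hee, ae_map_iff he'.aemeasurable
      (measurableSet_lt (measurable_convexConjugate Z V') measurable_const)]
    filter_upwards [hopt'] with ω h
    rw [convexConjugate_eq_of_isMaxOn h.1 h.2]
    exact EReal.coe_lt_top _
  have hfin' : ∀ᵐ ω ∂π', convexConjugate Z V (e' ω) < ⊤ := by
    refine ae_of_ae_map he'.aemeasurable (p := fun x => convexConjugate Z V x < ⊤) ?_
    rw [← hee, ae_map_iff he.aemeasurable
      (measurableSet_lt (measurable_convexConjugate Z V) measurable_const)]
    filter_upwards [hopt] with ω h
    rw [convexConjugate_eq_of_isMaxOn h.1 h.2]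
    exact EReal.coe_lt_top _
  set g : Vec d → ℝ := fun x => (convexConjugate Z V' x).toReal - (convexConjugate Z V x).toReal
    with hg
  have hgm : Measurable g :=
    (measurable_convexConjugate Z V').ereal_toReal.sub (measurable_convexConjugate Z V).ereal_toReal
  have hbd : ∀ t : ℝ, ‖Real.arctan t‖ ≤ Real.pi / 2 := fun t =>
    abs_le.2 ⟨by linarith [Real.neg_pi_div_two_lt_arctan t], (Real.arctan_lt_pi_div_two t).le⟩
  have hfm' : AEMeasurable (fun x => V x - V' x) (π'.map z') := hzz ▸ hf
  have i1 : Integrable (fun ω => Real.arctan (V (z ω) - V' (z ω))) π :=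
    Integrable.of_bound (Real.measurable_arctan.comp_aemeasurable
      (hf.comp_measurable hz)).aestronglyMeasurable _ (.of_forall fun _ => hbd _)
  have i1' : Integrable (fun ω => Real.arctan (V (z' ω) - V' (z' ω))) π' :=
    Integrable.of_bound (Real.measurable_arctan.comp_aemeasurable
      (hfm'.comp_measurable hz')).aestronglyMeasurable _ (.of_forall fun _ => hbd _)
  have i2 : Integrable (fun ω => Real.arctan (g (e ω))) π :=
    Integrable.of_bound (Real.measurable_arctan.comp
      (hgm.comp he)).aestronglyMeasurable _ (.of_forall fun _ => hbd _)
  have i2' : Integrable (fun ω => Real.arctan (g (e' ω))) π' :=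
    Integrable.of_bound (Real.measurable_arctan.comp
      (hgm.comp he')).aestronglyMeasurable _ (.of_forall fun _ => hbd _)
  have hle : ∀ᵐ ω ∂π, Real.arctan (V (z ω) - V' (z ω)) ≤ Real.arctan (g (e ω)) := by
    filter_upwards [hopt, hfin] with ω h h'
    refine Real.arctan_strictMono.monotone ?_
    have := inner_le_add_toReal_convexConjugate h.1 h'
    simp only [hg, convexConjugate_eq_of_isMaxOn h.1 h.2, EReal.toReal_coe]
    linarith
  have hle' : ∀ᵐ ω ∂π', Real.arctan (g (e' ω)) ≤ Real.arctan (V (z' ω) - V' (z' ω)) := by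
    filter_upwards [hopt', hfin'] with ω h h'
    refine Real.arctan_strictMono.monotone ?_
    have := inner_le_add_toReal_convexConjugate h.1 h'
    simp only [hg, convexConjugate_eq_of_isMaxOn h.1 h.2, EReal.toReal_coe]
    linarith
  have hzint : ∫ ω, Real.arctan (V (z ω) - V' (z ω)) ∂π =
      ∫ ω, Real.arctan (V (z' ω) - V' (z' ω)) ∂π' := by
    have a1 := integral_map hz.aemeasurable
      (Real.measurable_arctan.comp_aemeasurable hf).aestronglyMeasurable
    have a2 := integral_map hz'.aemeasurable
      (Real.measurable_arctan.comp_aemeasurable hfm').aestronglyMeasurable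
    exact a1.symm.trans ((congrArg (fun μ => ∫ x, Real.arctan (V x - V' x) ∂μ) hzz).trans a2)
  have heint : ∫ ω, Real.arctan (g (e ω)) ∂π = ∫ ω, Real.arctan (g (e' ω)) ∂π' := by
    have a1 := integral_map (μ := π) he.aemeasurable
      (Real.measurable_arctan.comp hgm).aestronglyMeasurable
    have a2 := integral_map (μ := π') he'.aemeasurable
      (Real.measurable_arctan.comp hgm).aestronglyMeasurable
    exact a1.symm.trans ((congrArg (fun μ => ∫ x, Real.arctan (g x) ∂μ) hee).trans a2)
  have heq : ∫ ω, Real.arctan (V (z ω) - V' (z ω)) ∂π = ∫ ω, Real.arctan (g (e ω)) ∂π := by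
    refine le_antisymm (integral_mono_ae i1 i2 hle) ?_
    rw [hzint, heint]
    exact integral_mono_ae i2' i1' hle'
  filter_upwards [(integral_eq_iff_of_ae_le i1 i2 hle).1 heq, hopt, hfin] with ω h1 h2 h3
  have h4 := Real.arctan_injective h1
  simp only [hg, convexConjugate_eq_of_isMaxOn h2.1 h2.2, EReal.toReal_coe] at h4
  exact isMaxOn_of_add_toReal_convexConjugate_le h3 (by linarith)

/-! ### The dual problem -/

section Dual

variable {d : ℕ} {Ω : Type*} [MeasurableSpace Ω] {π : Measure Ω} {Z : Set (Vec d)}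
  {V W : Vec d → ℝ} {z e : Ω → Vec d}

theorem DualAdmissible.integrable_comp (hz : Measurable z) (he : Measurable e)
    (hW : DualAdmissible Z (π.map z) (π.map e) W) :
    Integrable (fun ω => W (z ω) + (convexConjugate Z W (e ω)).toReal) π :=
  (hW.integrable.comp_measurable hz).add (hW.integrable_conjugate.comp_measurable he)

theorem DualAdmissible.dualObjective_eq (hz : Measurable z) (he : Measurable e)
    (hW : DualAdmissible Z (π.map z) (π.map e) W) :
    dualObjective Z (π.map z) (π.map e) W =
      ∫ ω, (W (z ω) + (convexConjugate Z W (e ω)).toReal) ∂π := by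
  rw [dualObjective, integral_map hz.aemeasurable hW.integrable.aestronglyMeasurable,
    integral_map he.aemeasurable hW.integrable_conjugate.aestronglyMeasurable]
  exact (integral_add (hW.integrable.comp_measurable hz)
    (hW.integrable_conjugate.comp_measurable he)).symm

theorem DualAdmissible.ae_inner_le (he : Measurable e)
    (hW : DualAdmissible Z (π.map z) (π.map e) W) (hzZ : ∀ᵐ ω ∂π, z ω ∈ Z) :
    ∀ᵐ ω ∂π, inner ℝ (z ω) (e ω) ≤ W (z ω) + (convexConjugate Z W (e ω)).toReal := by
  filter_upwards [hzZ, ae_of_ae_map he.aemeasurable hW.conjugate_lt_top] with ω h1 h2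
  exact inner_le_add_toReal_convexConjugate h1 h2

theorem integrable_inner_of_isCompact (hZ : IsCompact Z) (hz : Measurable z) (he : Measurable e)
    (hzZ : ∀ᵐ ω ∂π, z ω ∈ Z) (hint : Integrable e π) :
    Integrable (fun ω => inner ℝ (z ω) (e ω)) π := by
  obtain ⟨R, hR⟩ := hZ.isBounded.exists_norm_le
  refine (hint.norm.const_mul R).mono' (hz.inner he).aestronglyMeasurable ?_
  filter_upwards [hzZ] with ω h
  exact (norm_inner_le_norm _ _).trans (mul_le_mul_of_nonneg_right (hR _ h) (norm_nonneg _))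

/-- A potential for which almost all choices are optimal is integrable when tastes are: comparing a
choice `z` with a fixed optimal choice gives `|V z| ≤ c + 2 R ‖e‖`. -/
theorem integrable_comp_of_isMaxOn [IsProbabilityMeasure π] (hZ : IsCompact Z)
    (hz : Measurable z) (hV : AEMeasurable V (π.map z)) (hint : Integrable e π)
    (hopt : ∀ᵐ ω ∂π, z ω ∈ Z ∧ IsMaxOn (fun x => inner ℝ x (e ω) - V x) Z (z ω)) :
    Integrable (fun ω => V (z ω)) π := by
  obtain ⟨R, hR⟩ := hZ.isBounded.exists_norm_le
  obtain ⟨ω₀, hω₀, hmax₀⟩ := hopt.exists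
  have hR0 : 0 ≤ R := (norm_nonneg _).trans (hR _ hω₀)
  have hbd : ∀ x ∈ Z, ∀ y ∈ Z, ∀ v : Vec d, |inner ℝ x v - inner ℝ y v| ≤ 2 * R * ‖v‖ := by
    intro x hx y hy v
    rw [← inner_sub_left]
    refine (abs_real_inner_le_norm _ _).trans (mul_le_mul_of_nonneg_right ?_ (norm_nonneg _))
    linarith [norm_sub_le x y, hR x hx, hR y hy]
  refine Integrable.mono'
    (g := fun ω => |V (z ω₀)| + 2 * R * ‖e ω₀‖ + 2 * R * ‖e ω‖)
    ((integrable_const _).add (hint.norm.const_mul (2 * R)))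
    (hV.comp_measurable hz).aestronglyMeasurable ?_
  filter_upwards [hopt] with ω h
  have h1 : inner ℝ (z ω₀) (e ω) - V (z ω₀) ≤ inner ℝ (z ω) (e ω) - V (z ω) := h.2 hω₀
  have h2 : inner ℝ (z ω) (e ω₀) - V (z ω) ≤ inner ℝ (z ω₀) (e ω₀) - V (z ω₀) := hmax₀ h.1
  have h3 := abs_le.1 (hbd _ h.1 _ hω₀ (e ω))
  have h4 := abs_le.1 (hbd _ h.1 _ hω₀ (e ω₀))
  have h5 := neg_abs_le (V (z ω₀))
  have h6 := le_abs_self (V (z ω₀))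
  have h7 : 0 ≤ 2 * R * ‖e ω‖ := by positivity
  have h8 : 0 ≤ 2 * R * ‖e ω₀‖ := by positivity
  exact abs_le.2 ⟨by linarith [h4.1], by linarith [h3.2]⟩

theorem dualAdmissible_of_isMaxOn [IsProbabilityMeasure π] (hZ : IsCompact Z)
    (hz : Measurable z) (he : Measurable e) (hV : AEMeasurable V (π.map z))
    (hint : Integrable e π)
    (hopt : ∀ᵐ ω ∂π, z ω ∈ Z ∧ IsMaxOn (fun x => inner ℝ x (e ω) - V x) Z (z ω)) :
    DualAdmissible Z (π.map z) (π.map e) V where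
  integrable := (integrable_map_measure hV.aestronglyMeasurable hz.aemeasurable).2
    (integrable_comp_of_isMaxOn hZ hz hV hint hopt)
  conjugate_lt_top := by
    rw [ae_map_iff he.aemeasurable
      (measurableSet_lt (measurable_convexConjugate Z V) measurable_const)]
    filter_upwards [hopt] with ω h
    rw [convexConjugate_eq_of_isMaxOn h.1 h.2]
    exact EReal.coe_lt_top _
  integrable_conjugate := by
    rw [integrable_map_measure
      (measurable_convexConjugate Z V).ereal_toReal.aestronglyMeasurable he.aemeasurable]
    refine ((integrable_inner_of_isCompact hZ hz he (hopt.mono fun _ h => h.1) hint).sub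
      (integrable_comp_of_isMaxOn hZ hz hV hint hopt)).congr ?_
    filter_upwards [hopt] with ω h
    simp only [Function.comp_apply, Pi.sub_apply, convexConjugate_eq_of_isMaxOn h.1 h.2,
      EReal.toReal_coe]

/-- For a potential supporting the coupling the objective attains the lower bound `∫ ⟨z, e⟩`. -/
theorem dualObjective_eq_integral_inner (hz : Measurable z) (he : Measurable e)
    (hV : DualAdmissible Z (π.map z) (π.map e) V)
    (hopt : ∀ᵐ ω ∂π, z ω ∈ Z ∧ IsMaxOn (fun x => inner ℝ x (e ω) - V x) Z (z ω)) :
    dualObjective Z (π.map z) (π.map e) V = ∫ ω, inner ℝ (z ω) (e ω) ∂π := by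
  rw [hV.dualObjective_eq hz he]
  refine integral_congr_ae ?_
  filter_upwards [hopt] with ω h
  rw [convexConjugate_eq_of_isMaxOn h.1 h.2, EReal.toReal_coe, add_sub_cancel]

theorem isDualMinimizer_of_isMaxOn [IsProbabilityMeasure π] (hZ : IsCompact Z)
    (hz : Measurable z) (he : Measurable e) (hV : AEMeasurable V (π.map z))
    (hint : Integrable e π)
    (hopt : ∀ᵐ ω ∂π, z ω ∈ Z ∧ IsMaxOn (fun x => inner ℝ x (e ω) - V x) Z (z ω)) :
    IsDualMinimizer Z (π.map z) (π.map e) V := by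
  have hadm := dualAdmissible_of_isMaxOn hZ hz he hV hint hopt
  have hzZ := hopt.mono fun _ h => h.1
  refine ⟨hadm, fun W hW => ?_⟩
  rw [dualObjective_eq_integral_inner hz he hadm hopt, hW.dualObjective_eq hz he]
  exact integral_mono_ae (integrable_inner_of_isCompact hZ hz he hzZ hint)
    (hW.integrable_comp hz he) (hW.ae_inner_le he hzZ)

/-- Complementary slackness: if the coupling consists of optimal choices for some potential, its
choices are optimal for every solution of the dual problem. -/
theorem IsDualMinimizer.ae_isMaxOn [IsProbabilityMeasure π] (hZ : IsCompact Z)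
    (hz : Measurable z) (he : Measurable e) (hV : AEMeasurable V (π.map z))
    (hint : Integrable e π)
    (hopt : ∀ᵐ ω ∂π, z ω ∈ Z ∧ IsMaxOn (fun x => inner ℝ x (e ω) - V x) Z (z ω))
    (hW : IsDualMinimizer Z (π.map z) (π.map e) W) :
    ∀ᵐ ω ∂π, IsMaxOn (fun x => inner ℝ x (e ω) - W x) Z (z ω) := by
  have hadm := dualAdmissible_of_isMaxOn hZ hz he hV hint hopt
  have hzZ := hopt.mono fun _ h => h.1
  have hle := hW.1.ae_inner_le he hzZ
  have i1 := integrable_inner_of_isCompact hZ hz he hzZ hint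
  have i2 := hW.1.integrable_comp hz he
  have heq : ∫ ω, inner ℝ (z ω) (e ω) ∂π =
      ∫ ω, (W (z ω) + (convexConjugate Z W (e ω)).toReal) ∂π := by
    refine le_antisymm (integral_mono_ae i1 i2 hle) ?_
    rw [← hW.1.dualObjective_eq hz he, ← dualObjective_eq_integral_inner hz he hadm hopt]
    exact hW.2 V hadm
  filter_upwards [(integral_eq_iff_of_ae_le i1 i2 hle).1 heq,
    ae_of_ae_map he.aemeasurable hW.1.conjugate_lt_top] with ω h1 h2
  exact isMaxOn_of_add_toReal_convexConjugate_le h2 h1.ge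

end Dual

/-! ### Subgradients almost everywhere -/

theorem measurable_gradient {d : ℕ} (V : Vec d → ℝ) : Measurable (gradient V) :=
  (InnerProductSpace.toDual ℝ (Vec d)).symm.continuous.measurable.comp (measurable_fderiv ℝ V)

/-- If choices are optimal for both `V` and `W`, then `∇V` is a subgradient of `W`. The point is
that the set of such qualities is measurable, so that the property passes from the coupling to its
marginal. -/
theorem ae_map_isMaxOn_gradient {d : ℕ} {Ω : Type*} [MeasurableSpace Ω] {π : Measure Ω}
    {Z : Set (Vec d)} {V W : Vec d → ℝ} {z e : Ω → Vec d} (hz : Measurable z)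
    (hW : ContinuousOn W (interior Z)) (hint : ∀ᵐ ω ∂π, z ω ∈ interior Z)
    (hdiff : ∀ᵐ ω ∂π, DifferentiableAt ℝ V (z ω))
    (hoptV : ∀ᵐ ω ∂π, IsMaxOn (fun x => inner ℝ x (e ω) - V x) Z (z ω))
    (hoptW : ∀ᵐ ω ∂π, IsMaxOn (fun x => inner ℝ x (e ω) - W x) Z (z ω)) :
    ∀ᵐ x ∂(π.map z), x ∈ interior Z ∧ DifferentiableAt ℝ V x ∧
      IsMaxOn (fun y => inner ℝ y (gradient V x) - W y) Z x := by
  classical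
  -- `W` is replaced by a measurable function that agrees with it on the interior
  set W' : Vec d → ℝ := (interior Z).piecewise W 0 with hW'
  have hW'm : Measurable W' :=
    hW.measurable_piecewise continuousOn_const isOpen_interior.measurableSet
  have hms : MeasurableSet {x | x ∈ interior Z ∧ DifferentiableAt ℝ V x ∧
      convexConjugate Z W (gradient V x) ≤ ((inner ℝ x (gradient V x) - W' x : ℝ) : EReal)} :=
    isOpen_interior.measurableSet.inter ((measurableSet_of_differentiableAt ℝ V).inter
      (measurableSet_le ((measurable_convexConjugate Z W).comp (measurable_gradient V))
        ((measurable_id.inner (measurable_gradient V)).sub hW'm).coe_real_ereal))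
  have hae : ∀ᵐ x ∂(π.map z), x ∈ interior Z ∧ DifferentiableAt ℝ V x ∧
      convexConjugate Z W (gradient V x) ≤
        ((inner ℝ x (gradient V x) - W' x : ℝ) : EReal) := by
    rw [ae_map_iff hz.aemeasurable hms]
    filter_upwards [hint, hdiff, hoptV, hoptW] with ω h1 h2 h3 h4
    refine ⟨h1, h2, ?_⟩
    rw [gradient_eq_of_isMaxOn_inner_sub h1 h3 h2, hW', Set.piecewise_eq_of_mem _ _ _ h1]
    exact convexConjugate_le_iff_isMaxOn.2 h4
  filter_upwards [hae] with x ⟨h1, h2, h3⟩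
  rw [hW', Set.piecewise_eq_of_mem _ _ _ h1] at h3
  exact ⟨h1, h2, convexConjugate_le_iff_isMaxOn.1 h3⟩

theorem IsConvexFunOn.continuousOn_interior {d : ℕ} {Z : Set (Vec d)} {f : Vec d → ℝ}
    (hf : IsConvexFunOn Z f) : ContinuousOn f (interior Z) := by
  obtain ⟨F, hF, hfF⟩ := hf
  exact (hF.continuousOn_interior.mono (interior_mono (subset_convexHull ℝ Z))).congr
    (hfF.mono interior_subset)

theorem mem_closure_of_ae_of_mem_support {d : ℕ} {μ : Measure (Vec d)} {P : Vec d → Prop}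
    (hP : ∀ᵐ x ∂μ, P x) {O : Set (Vec d)} (hO : IsOpen O) {x : Vec d} (hxO : x ∈ O)
    (hx : x ∈ μ.support) : x ∈ closure {y ∈ O | P y} := by
  rw [mem_closure_iff_nhds]
  intro U hU
  have hpos := (Measure.mem_support_iff_forall x).1 hx _ (Filter.inter_mem hU (hO.mem_nhds hxO))
  by_contra hne
  have hsub : U ∩ O ⊆ {y | ¬ P y} := fun y hy hPy => hne ⟨y, hy.1, hy.2, hPy⟩
  exact hpos.ne' (measure_mono_null hsub (ae_iff.1 hP))

/-! ### Markets in equilibrium -/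

namespace HedonicMarket

variable {dx dz dy : ℕ} {M : HedonicMarket dx dz dy}

theorem utility_sub_price_eq (hH : M.HasUnobservedHeterogeneity) (hS : M.IsLinearInTaste)
    {t : Vec dx × Vec dz} (ht : t ∈ M.consumers) {z : Vec dz} (hz : z ∈ M.Z) :
    M.U t z - M.price z = inner ℝ z t.2 - M.potential t.1 z := by
  rw [hH.decomposition t ht z hz, hS t ht z hz, potential]
  ring

theorem IsRegular.differentiableAt_U (hR : M.IsRegular) {t : Vec dx × Vec dz}
    (ht : t ∈ M.consumers) {z : Vec dz} (hz : z ∈ interior M.Z) :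
    DifferentiableAt ℝ (M.U t) z := by
  have h : ContDiffOn ℝ 2 (M.U t) M.Z :=
    hR.contDiffOn_U.comp (f := fun z => (t, z)) (by fun_prop) fun z hz => ⟨ht, hz⟩
  exact (h.differentiableOn two_ne_zero).differentiableAt (mem_interior_iff_mem_nhds.1 hz)

theorem IsRegular.differentiableAt_cost (hR : M.IsRegular) {y : Vec dy}
    (hy : y ∈ M.producers) {z : Vec dz} (hz : z ∈ interior M.Z) :
    DifferentiableAt ℝ (M.cost y) z := by
  have h : ContDiffOn ℝ 2 (M.cost y) M.Z :=
    hR.contDiffOn_cost.comp (f := fun z => (y, z)) (by fun_prop) fun z hz => ⟨hy, hz⟩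
  exact (h.differentiableOn two_ne_zero).differentiableAt (mem_interior_iff_mem_nhds.1 hz)

theorem differentiableAt_Ubar (hH : M.HasUnobservedHeterogeneity) (hR : M.IsRegular)
    (hS : M.IsLinearInTaste) {x : Vec dx} (hx : x ∈ M.observables) {z : Vec dz}
    (hz : z ∈ interior M.Z) : DifferentiableAt ℝ (M.Ubar x) z := by
  obtain ⟨t, ht, rfl⟩ := hx
  have h : DifferentiableAt ℝ (fun z' => M.U t z' - inner ℝ z' t.2) z :=
    (hR.differentiableAt_U ht hz).sub (differentiableAt_id.inner ℝ (differentiableAt_const _))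
  refine h.congr_of_eventuallyEq ?_
  filter_upwards [mem_interior_iff_mem_nhds.1 hz] with z' hz'
  rw [hH.decomposition t ht z' hz', hS t ht z' hz', add_sub_cancel_right]

/-- In equilibrium the price is differentiable at almost every traded quality: up to constants, it
lies above the utility of the consumer and below the cost of the producer, with equality at the
traded quality. -/
theorem IsEquilibrium.ae_differentiableAt_price (hEC : M.IsEquilibrium) (hR : M.IsRegular) :
    ∀ᵐ w ∂M.joint, DifferentiableAt ℝ M.price w.2.1 := by
  have hcons : ∀ᵐ w ∂M.joint, w.1 ∈ M.consumers :=
    ae_of_ae_map measurable_fst.aemeasurable (hEC.map_consumer ▸ M.ae_mem_consumers)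
  have hprod : ∀ᵐ w ∂M.joint, w.2.2 ∈ M.producers :=
    ae_of_ae_map measurable_snd.snd.aemeasurable (hEC.map_producer ▸ M.ae_mem_producers)
  filter_upwards [hcons, hprod, hEC.interior, hEC.consumer_optimal, hEC.producer_optimal]
    with w ht hy hz hc hp
  have hnhds := mem_interior_iff_mem_nhds.1 hz
  refine differentiableAt_of_le_of_le
    (f := fun z => M.U w.1 z - (M.U w.1 w.2.1 - M.price w.2.1))
    (h := fun z => M.cost w.2.2 z + (M.price w.2.1 - M.cost w.2.2 w.2.1))
    ((hR.differentiableAt_U ht hz).sub_const _) ((hR.differentiableAt_cost hy hz).add_const _)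
    ?_ ?_ (by ring) (by ring)
  · filter_upwards [hnhds] with z hz'
    have : M.U w.1 z - M.price z ≤ M.U w.1 w.2.1 - M.price w.2.1 := hc hz'
    linarith
  · filter_upwards [hnhds] with z hz'
    have : M.price z - M.cost w.2.2 z ≤ M.price w.2.1 - M.cost w.2.2 w.2.1 := hp hz'
    linarith

theorem IsEquilibrium.ae_isMaxOn_potential (hEC : M.IsEquilibrium)
    (hH : M.HasUnobservedHeterogeneity) (hS : M.IsLinearInTaste) :
    ∀ᵐ w ∂M.joint, w.1 ∈ M.consumers ∧
      IsMaxOn (fun z => inner ℝ z w.1.2 - M.potential w.1.1 z) M.Z w.2.1 := by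
  have hcons : ∀ᵐ w ∂M.joint, w.1 ∈ M.consumers :=
    ae_of_ae_map measurable_fst.aemeasurable (hEC.map_consumer ▸ M.ae_mem_consumers)
  filter_upwards [hcons, hEC.feasible, hEC.consumer_optimal] with w ht hz hc
  refine ⟨ht, fun z hz' => ?_⟩
  have : M.U w.1 z - M.price z ≤ M.U w.1 w.2.1 - M.price w.2.1 := hc hz'
  rwa [utility_sub_price_eq hH hS ht hz', utility_sub_price_eq hH hS ht hz] at this

theorem fst_Pxz (hEC : M.IsEquilibrium) (hH : M.HasUnobservedHeterogeneity) :
    M.Pxz.fst = M.Px := by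
  have := M.isProbabilityMeasure_Px
  have := M.isMarkovKernel_Peps
  rw [← Measure.fst_compProd M.Px M.Peps, ← hH.disintegration, ← hEC.map_consumer, Pxz,
    Measure.fst, Measure.fst, Measure.map_map (by fun_prop) (by fun_prop),
    Measure.map_map (by fun_prop) (by fun_prop)]
  rfl

/-- Conditionally on the observable type `x`, the equilibrium is a coupling of `P_{ε|x}` and
`P_{z|x}` (and of the producer types) in which almost every quality is optimal for the potential
`V(x, ·)`. -/
theorem exists_conditional_coupling (hEC : M.IsEquilibrium) (hH : M.HasUnobservedHeterogeneity)
    (hR : M.IsRegular) (hS : M.IsLinearInTaste) :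
    ∃ κ : Kernel (Vec dx) (Vec dz × Vec dz × Vec dy), IsMarkovKernel κ ∧ ∀ᵐ x ∂M.Px,
      x ∈ M.observables ∧ M.PzGiven x = (κ x).map (fun w => w.2.1) ∧
      M.Peps x = (κ x).map Prod.fst ∧
      ∀ᵐ w ∂(κ x), w.2.1 ∈ interior M.Z ∧ DifferentiableAt ℝ M.price w.2.1 ∧
        IsMaxOn (fun z => inner ℝ z w.1 - M.potential x z) M.Z w.2.1 := by
  have := M.isProbabilityMeasure_Px
  have := M.isMarkovKernel_Peps
  let A : (Vec dx × Vec dz) × Vec dz × Vec dy ≃ᵐ Vec dx × Vec dz × Vec dz × Vec dy :=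
    MeasurableEquiv.prodAssoc
  set ρ : Measure (Vec dx × Vec dz × Vec dz × Vec dy) := M.joint.map A with hρ
  have : IsProbabilityMeasure ρ := Measure.isProbabilityMeasure_map A.measurable.aemeasurable
  have hfst : ρ.fst = M.Px := by
    rw [← fst_Pxz hEC hH, Pxz, hρ, Measure.fst, Measure.fst,
      Measure.map_map (by fun_prop) (by fun_prop), Measure.map_map (by fun_prop) (by fun_prop)]
    rfl
  have hdis : M.Px ⊗ₘ ρ.condKernel = ρ := hfst ▸ ρ.disintegrate ρ.condKernel
  have hz : ∀ᵐ x ∂M.Px, ρ.condKernel.map (fun w => w.2.1) x = M.PzGiven x := by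
    have hm : Measurable fun w : Vec dz × Vec dz × Vec dy => w.2.1 := by fun_prop
    have := Kernel.IsMarkovKernel.map ρ.condKernel hm
    have h := eq_condKernel_of_measure_eq_compProd (ρ := M.Pxz)
      (ρ.condKernel.map (fun w => w.2.1)) (by
        rw [fst_Pxz hEC hH, Measure.compProd_map hm, hdis, hρ,
          Measure.map_map (by fun_prop) A.measurable, Pxz]
        rfl)
    rwa [fst_Pxz hEC hH] at h
  have he : M.Peps =ᵐ[M.Px] ρ.condKernel.map Prod.fst := by
    have := Kernel.IsMarkovKernel.map ρ.condKernel
      (measurable_fst : Measurable (Prod.fst : Vec dz × Vec dz × Vec dy → Vec dz))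
    refine Kernel.ae_eq_of_compProd_eq ?_
    rw [← hH.disintegration, ← hEC.map_consumer, Measure.compProd_map measurable_fst, hdis, hρ,
      Measure.map_map (by fun_prop) A.measurable]
    rfl
  -- transporting along an equivalence preserves almost sure properties without measurability
  have hae : ∀ᵐ w ∂ρ, (w.1, w.2.1) ∈ M.consumers ∧ w.2.2.1 ∈ interior M.Z ∧
      DifferentiableAt ℝ M.price w.2.2.1 ∧
      IsMaxOn (fun z => inner ℝ z w.2.1 - M.potential w.1 z) M.Z w.2.2.1 := by
    rw [hρ, A.measurableEmbedding.ae_map_iff]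
    filter_upwards [hEC.ae_isMaxOn_potential hH hS, hEC.ae_differentiableAt_price hR,
      hEC.interior] with w h1 h2 h3
    exact ⟨h1.1, h3, h2, h1.2⟩
  rw [← hdis] at hae
  refine ⟨ρ.condKernel, inferInstance, ?_⟩
  filter_upwards [Measure.ae_ae_of_ae_compProd hae, hz, he] with x h1 h2 h3
  obtain ⟨w, hw⟩ := h1.exists
  refine ⟨⟨_, hw.1, rfl⟩, ?_, ?_, h1.mono fun w hw => hw.2⟩
  · rw [← h2, Kernel.map_apply _ (by fun_prop)]
  · rw [h3, Kernel.map_apply _ measurable_fst]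

/-- At a quality where `V(x, ·)` is differentiable with a gradient that makes the quality optimal
for the potential of a second market with the same prices, the marginal utilities agree. -/
theorem gradient_Ubar_eq {dy' : ℕ} {M' : HedonicMarket dx dz dy'} {x : Vec dx} {z : Vec dz}
    (hp : Set.EqOn M'.price M.price M.Z) (hz : z ∈ interior M.Z)
    (hU : DifferentiableAt ℝ (M.Ubar x) z) (hU' : DifferentiableAt ℝ (M'.Ubar x) z)
    (hV : DifferentiableAt ℝ (M.potential x) z)
    (hmax : IsMaxOn (fun y => inner ℝ y (gradient (M.potential x) z) - M'.potential x y) M.Z z) :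
    gradient (M'.Ubar x) z = gradient (M.Ubar x) z := by
  have hpe : M'.price =ᶠ[nhds z] M.price := by
    filter_upwards [mem_interior_iff_mem_nhds.1 hz] with y hy using hp hy
  have hprice : DifferentiableAt ℝ M.price z := by
    have h := hV.add hU
    refine h.congr_of_eventuallyEq (.of_forall fun y => ?_)
    simp [potential]
  have hprice' : DifferentiableAt ℝ M'.price z := hprice.congr_of_eventuallyEq hpe
  have hV' : DifferentiableAt ℝ (M'.potential x) z := hprice'.sub hU'
  have h1 : fderiv ℝ (M'.potential x) z = fderiv ℝ (M.potential x) z :=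
    (InnerProductSpace.toDual ℝ (Vec dz)).symm.injective
      (gradient_eq_of_isMaxOn_inner_sub hz hmax hV')
  have h2 : fderiv ℝ (M'.potential x) z = fderiv ℝ M'.price z - fderiv ℝ (M'.Ubar x) z :=
    fderiv_fun_sub hprice' hU'
  have h3 : fderiv ℝ (M.potential x) z = fderiv ℝ M.price z - fderiv ℝ (M.Ubar x) z :=
    fderiv_fun_sub hprice hU
  rw [h2, h3, hpe.fderiv_eq, sub_right_inj] at h1
  rw [gradient, gradient, h1]

end HedonicMarket

/-! ### Identification of marginal utility and the dual problem -/

theorem mainTheorem5 {dx dz dy : ℕ} (M : HedonicMarket dx dz dy)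
    (hEC : M.IsEquilibrium) (hH : M.HasUnobservedHeterogeneity) (hR : M.IsRegular)
    (hS : M.IsLinearInTaste) (hC : M.HasConvexPotential) :
    -- the marginal utility is the only one compatible with `(P_{xz}, p)`
    (∀ (dy' : ℕ) (M' : HedonicMarket dx dz dy'),
      M'.IsEquilibrium → M'.HasUnobservedHeterogeneity → M'.IsRegular →
      M'.IsLinearInTaste → M'.HasConvexPotential →
      M'.Z = M.Z → M'.Peps = M.Peps → M'.Pxz = M.Pxz → Set.EqOn M'.price M.price M.Z →
      ∀ᵐ x ∂M.Px, ∀ᵐ z ∂(M.PzGiven x),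
        DifferentiableAt ℝ (M.Ubar x) z ∧ DifferentiableAt ℝ (M'.Ubar x) z ∧
          gradient (M'.Ubar x) z = gradient (M.Ubar x) z) ∧
    -- the potential is the convex solution of the dual problem
    (∀ x z, M.Ubar x z = M.price z - M.potential x z) ∧
    (∀ᵐ x ∂M.Px, Integrable (fun e : Vec dz => e) (M.Peps x) →
      IsConvexFunOn M.Z (M.potential x) ∧
      IsDualMinimizer M.Z (M.PzGiven x) (M.Peps x) (M.potential x) ∧
      ∀ W : Vec dz → ℝ, IsConvexFunOn M.Z W →
        IsDualMinimizer M.Z (M.PzGiven x) (M.Peps x) W →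
        (∀ᵐ z ∂(M.PzGiven x), DifferentiableAt ℝ (M.potential x) z ∧
          ∀ z' ∈ M.Z, W z + inner ℝ (gradient (M.potential x) z) (z' - z) ≤ W z') ∧
        (∀ O : Set (Vec dz), IsOpen O → IsPreconnected O → O ⊆ (M.PzGiven x).support →
          ∃ c : ℝ, ∀ z ∈ O, W z = M.potential x z + c)) := by
  refine ⟨?_, fun x z => (sub_sub_cancel _ _).symm, ?_⟩
  · intro dy' M' hEC' hH' hR' hS' hC' hZ hPeps hPxz hp
    obtain ⟨κ, hκm, hκ⟩ := HedonicMarket.exists_conditional_coupling hEC hH hR hS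
    obtain ⟨κ', hκm', hκ'⟩ := HedonicMarket.exists_conditional_coupling hEC' hH' hR' hS'
    have hPx : M'.Px = M.Px := by
      rw [← HedonicMarket.fst_Pxz hEC hH, ← HedonicMarket.fst_Pxz hEC' hH', hPxz]
    have hPz : M'.PzGiven = M.PzGiven := by
      simp only [HedonicMarket.PzGiven, hPxz]
    rw [hPx, hPz, hPeps, hZ] at hκ'
    filter_upwards [hκ, hκ'] with x ⟨hx, hμ, hν, hopt⟩ ⟨hx', hμ', hν', hopt'⟩
    have hzm : Measurable fun w : Vec dz × Vec dz × Vec dy => w.2.1 := by fun_prop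
    have hV := (hC x hx).continuousOn_interior
    have hV' := (hC' x hx').continuousOn_interior
    rw [hZ] at hV'
    have hint : ∀ᵐ z ∂(M.PzGiven x), z ∈ interior M.Z :=
      hμ ▸ ae_map_mem_interior hzm (hopt.mono fun w hw => hw.1)
    -- the choices in the first market are optimal for the potential of the second
    have hmax := isMaxOn_of_map_eq_map hzm measurable_fst (by fun_prop) measurable_fst
      (hμ.symm.trans hμ') (hν.symm.trans hν')
      (hμ ▸ (aemeasurable_of_continuousOn_interior hV hint).sub
        (aemeasurable_of_continuousOn_interior hV' hint))
      (hopt.mono fun w hw => ⟨interior_subset hw.1, hw.2.2⟩)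
      (hopt'.mono fun w hw => ⟨interior_subset hw.1, hw.2.2⟩)
    rw [hμ]
    filter_upwards [ae_map_isMaxOn_gradient hzm hV' (hopt.mono fun w hw => hw.1)
      (hopt.mono fun w hw => hw.2.1.sub (HedonicMarket.differentiableAt_Ubar hH hR hS hx hw.1))
      (hopt.mono fun w hw => hw.2.2) hmax] with z ⟨hz, hVz, hmaxz⟩
    have hU := HedonicMarket.differentiableAt_Ubar hH hR hS hx hz
    have hU' := HedonicMarket.differentiableAt_Ubar hH' hR' hS' hx' (hZ ▸ hz)
    exact ⟨hU, hU', HedonicMarket.gradient_Ubar_eq hp hz hU hU' hVz hmaxz⟩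
  · obtain ⟨κ, hκm, hκ⟩ := HedonicMarket.exists_conditional_coupling hEC hH hR hS
    filter_upwards [hκ] with x ⟨hx, hμ, hν, hopt⟩ hfm
    have hzm : Measurable fun w : Vec dz × Vec dz × Vec dy => w.2.1 := by fun_prop
    have hV := (hC x hx).continuousOn_interior
    have hint : ∀ᵐ z ∂(M.PzGiven x), z ∈ interior M.Z :=
      hμ ▸ ae_map_mem_interior hzm (hopt.mono fun w hw => hw.1)
    have hVm := aemeasurable_of_continuousOn_interior hV hint
    have hfm' : Integrable (Prod.fst : Vec dz × Vec dz × Vec dy → Vec dz) (κ x) := by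
      rw [hν] at hfm
      exact hfm.comp_measurable measurable_fst
    have hmax : ∀ᵐ w ∂(κ x), w.2.1 ∈ M.Z ∧
        IsMaxOn (fun z => inner ℝ z w.1 - M.potential x z) M.Z w.2.1 :=
      hopt.mono fun w hw => ⟨interior_subset hw.1, hw.2.2⟩
    rw [hμ] at hVm
    refine ⟨hC x hx, ?_, fun W hWc hW => ?_⟩
    · rw [hμ, hν]
      exact isDualMinimizer_of_isMaxOn M.isCompact_Z hzm measurable_fst hVm hfm' hmax
    have hmaxW : ∀ᵐ w ∂(κ x), IsMaxOn (fun z => inner ℝ z w.1 - W z) M.Z w.2.1 := by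
      rw [hμ, hν] at hW
      exact hW.ae_isMaxOn M.isCompact_Z hzm measurable_fst hVm hfm' hmax
    have hWcont := hWc.continuousOn_interior
    have hdiff : ∀ᵐ w ∂(κ x), DifferentiableAt ℝ (M.potential x) w.2.1 :=
      hopt.mono fun w hw => hw.2.1.sub (HedonicMarket.differentiableAt_Ubar hH hR hS hx hw.1)
    -- `∇V` is almost everywhere a subgradient of `F`; used for `F = W` and for `F = V`
    have hsub : ∀ F : Vec dz → ℝ, ContinuousOn F (interior M.Z) →
        (∀ᵐ w ∂(κ x), IsMaxOn (fun z => inner ℝ z w.1 - F z) M.Z w.2.1) →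
        ∀ᵐ z ∂(M.PzGiven x), DifferentiableAt ℝ (M.potential x) z ∧
          ∀ z' ∈ M.Z, F z + inner ℝ (gradient (M.potential x) z) (z' - z) ≤ F z' := by
      intro F hF hmaxF
      rw [hμ]
      filter_upwards [ae_map_isMaxOn_gradient hzm hF (hopt.mono fun w hw => hw.1) hdiff
        (hopt.mono fun w hw => hw.2.2) hmaxF] with z ⟨_, h2, h3⟩
      refine ⟨h2, fun z' hz' => ?_⟩
      have h4 : inner ℝ z' (gradient (M.potential x) z) - F z' ≤
        inner ℝ z (gradient (M.potential x) z) - F z := h3 hz'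
      rw [inner_sub_right, real_inner_comm z', real_inner_comm z]
      linarith
    have hsubW := hsub W hWcont hmaxW
    refine ⟨hsubW, fun O hO hOc hOs => ?_⟩
    have hOZ : O ⊆ M.Z := hOs.trans (Measure.support_subset_of_isClosed M.isCompact_Z.isClosed
      (hint.mono fun z hz => interior_subset hz))
    have hOi : O ⊆ interior M.Z := interior_maximal hOZ hO
    refine exists_eq_add_const_of_common_subgradient hO hOc (hV.mono hOi) (hWcont.mono hOi)
      fun z hz => mem_closure_of_ae_of_mem_support ?_ hO hz (hOs hz)
    filter_upwards [hsub _ hV (hopt.mono fun w hw => hw.2.2), hsubW] with y h1 h2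
    exact ⟨gradient (M.potential x) y, fun z' hz' => ⟨h1.2 z' (hOZ hz'), h2.2 z' (hOZ hz')⟩⟩
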